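/- Let $\mathcal{A}$ be an abelian category; classes of objects are denoted $\mathcal{X},\mathcal{Y},\mathcal{Z}\subseteq\mathcal{A}$. Definitions. $\mathrm{pd}_{\mathcal{Y}}(M)$ is the least $n\ge 0$ with $\mathrm{Ext}^j_{\mathcal{A}}(M,Y)=0$ for all $j>n$, $Y\in\mathcal{Y}$ (and $\infty$ if there is none), $\mathrm{pd}_{\mathcal{Y}}(\mathcal{X})=\sup_{X\in\mathcal{X}}\mathrm{pd}_{\mathcal{Y}}(X)$; $\mathrm{id}_{\mathcal{X}}(\mathcal{Y})$ is defined dually. $\mathcal{Z}$ is a *relative cogenerator* in $\mathcal{X}$ if $\mathcal{Z}\subseteq\mathcal{X}$ and each $X\in\mathcal{X}$ has an exact sequence $0\to X\to Z\to X'\to 0$ with $Z\in\mathcal{Z}$, $X'\in\mathcal{X}$. The pair $(\mathcal{X},\mathcal{Y})$ is *GP-admissible* if $\mathrm{pd}_{\mathcal{Y}}(\mathcal{X})=0$; every $A\in\mathcal{A}$ admits an epimorphism $X\to A$ with $X\in\mathcal{X}$; $\mathcal{X}$ and $\mathcal{Y}$ are closed under finite coproducts (in particular contain $0$ and are closed under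 isomorphisms); $\mathcal{X}$ is closed under extensions; and $\mathcal{X}\cap\mathcal{Y}$ is a relative cogenerator in $\mathcal{X}$. $\mathcal{GP}_{(\mathcal{X},\mathcal{Y})}$ is the class of objects isomorphic to $\mathrm{Im}(X_0\to X^0)$ for some acyclic complex $\eta:\cdots\to X_1\to X_0\to X^0\to X^1\to\cdots$ with all terms in $\mathcal{X}$ such that $\mathrm{Hom}_{\mathcal{A}}(\eta,Y)$ is acyclic for all $Y\in\mathcal{Y}$. $\mathcal{Y}^\wedge$ is the class of objects $M$ having an exact sequence $0\to Y_n\to\cdots\to Y_0\to M\to 0$ for some $n\ge 0$ with all $Y_i\in\mathcal{Y}$. A class is *left thick* (respectively *right thick*) if it is closed under extensions, direct summands, and kernels of epimorphisms (respectively cokernels of monomorphisms) between its objects. The pair $(\mathcal{X},\mathcal{Z})$ is *left Frobenius* if $\mathcal{X}$ is left thick, $\mathcal{Z}$ is closed under direct summands, $\mathcal{Z}$ is a relative cogenerator in $\mathcal{X}$, and $\mathrm{id}_{\mathcal{X}}(\mathcal{Z})=0$. Theorem. Let $(\mathcal{X},\mathcal{Y})$ be a GP-admissible pair in $\mathcal{A}$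 and $\omega:=\mathcal{X}\cap\mathcal{Y}$. Then: (a) The pairs $(\mathcal{GP}_{(\mathcal{X},\mathcal{Y})},\mathcal{Y})$, $(\mathcal{GP}_{(\mathcal{X},\mathcal{Y})},\omega)$ and $(\mathcal{X},\mathcal{Y}^\wedge)$ are GP-admissible. (b) If $\mathcal{Y}$ is closed under direct summands in $\mathcal{A}$ and $\mathcal{Y}\subseteq\mathcal{GP}_{(\mathcal{X},\mathcal{Y})}$, then the pair $(\mathcal{GP}_{(\mathcal{X},\mathcal{Y})},\mathcal{Y})$ is left Frobenius, every object of $\mathcal{Y}$ is a direct summand of an object of $\mathcal{X}$, and $\mathcal{Y}^\wedge$ is right thick. (c) If $\omega$ is closed under direct summands in $\mathcal{A}$, then $\mathcal{GP}_{(\mathcal{X},\mathcal{Y})}\cap\mathcal{Y}=\omega$. (d) If $\mathcal{Y}^\wedge$, $\omega$ and $\mathcal{X}\cap\mathcal{Y}^\wedge$ are closed under direct summands in $\mathcal{A}$, then $$\mathcal{GP}_{(\mathcal{X},\mathcal{Y})}=\mathcal{GP}_{(\mathcal{X},\mathcal{Y}^\wedge)}\quad\text{and}\quad \mathcal{GP}_{(\mathcal{X},\mathcal{Y})}\cap\mathcal{Y}^\wedge=\omega=\mathcal{X}\cap\mathcal{Y}^\wedge.$$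 -/

import Mathlib

open CategoryTheory CategoryTheory.Limits

universe w v u

namespace RelGorenstein

variable {C : Type u} [Category.{v} C] [Abelian C]

section Dimensions

variable [HasExt.{w} C]

/-- The relative projective dimension `pd_𝒴 (M)`: the minimum of all natural numbers `n` such that
`Ext^j(M, Y) = 0` for all `j > n` and all `Y ∈ 𝒴`, and `∞` if there is no such `n`. -/
noncomputable def relPd (𝒴 : ObjectProperty C) (M : C) : ℕ∞ :=
  sInf {d : ℕ∞ | ∃ n : ℕ, d = n ∧
    ∀ j : ℕ, n < j → ∀ Y : C, 𝒴 Y → Subsingleton (Abelian.Ext.{w} M Y j)}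

/-- The relative injective dimension `id_𝒳 (M)`: the minimum of all natural numbers `n` such that
`Ext^j(X, M) = 0` for all `j > n` and all `X ∈ 𝒳`, and `∞` if there is no such `n`. -/
noncomputable def relId (𝒳 : ObjectProperty C) (M : C) : ℕ∞ :=
  sInf {d : ℕ∞ | ∃ n : ℕ, d = n ∧
    ∀ j : ℕ, n < j → ∀ X : C, 𝒳 X → Subsingleton (Abelian.Ext.{w} X M j)}

/-- `pd_𝒴 (𝒳)`, the supremum of `pd_𝒴 (X)` over `X ∈ 𝒳`. -/
noncomputable def relPdClass (𝒴 𝒳 : ObjectProperty C) : ℕ∞ :=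
  ⨆ (X : C) (_ : 𝒳 X), relPd.{w} 𝒴 X

/-- `id_𝒳 (𝒴)`, the supremum of `id_𝒳 (Y)` over `Y ∈ 𝒴`. -/
noncomputable def relIdClass (𝒳 𝒴 : ObjectProperty C) : ℕ∞ :=
  ⨆ (Y : C) (_ : 𝒴 Y), relId.{w} 𝒳 Y

end Dimensions

/-- `𝒳` is `𝒳`-epic: every object `A` admits an epimorphism `X ⟶ A` with `X ∈ 𝒳`. -/
def IsSelfEpic (𝒳 : ObjectProperty C) : Prop :=
  ∀ A : C, ∃ (X : C) (p : X ⟶ A), 𝒳 X ∧ Epi p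

/-- `ω` is a relative quasi-cogenerator in `𝒳`: every `X ∈ 𝒳` admits an exact sequence
`0 ⟶ X ⟶ W ⟶ X' ⟶ 0` with `W ∈ ω` and `X' ∈ 𝒳`. -/
def IsRelativeQuasiCogenerator (ω 𝒳 : ObjectProperty C) : Prop :=
  ∀ X : C, 𝒳 X → ∃ (W X' : C) (i : X ⟶ W) (p : W ⟶ X') (h : i ≫ p = 0),
    (ShortComplex.mk i p h).ShortExact ∧ ω W ∧ 𝒳 X'

/-- `ω` is a relative cogenerator in `𝒳`. -/
def IsRelativeCogenerator (ω 𝒳 : ObjectProperty C) : Prop :=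
  ω ≤ 𝒳 ∧ IsRelativeQuasiCogenerator ω 𝒳

/-- `M` has a `𝒴`-resolution of length `n`, that is, there is an exact sequence
`0 ⟶ Y_n ⟶ ⋯ ⟶ Y_1 ⟶ Y_0 ⟶ M ⟶ 0` with all `Y_i ∈ 𝒴`. For `n = 0` this is an isomorphism
`Y_0 ≅ M`; for `n + 1` it is an exact sequence `0 ⟶ K ⟶ Y_0 ⟶ M ⟶ 0` spliced with a
`𝒴`-resolution of `K` of length `n`. -/
def HasResolution (𝒴 : ObjectProperty C) : ℕ → ObjectProperty C
  | 0 => fun M => ∃ Y : C, 𝒴 Y ∧ Nonempty (Y ≅ M)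
  | n + 1 => fun M => ∃ (K Y : C) (i : K ⟶ Y) (p : Y ⟶ M) (h : i ≫ p = 0),
      (ShortComplex.mk i p h).ShortExact ∧ 𝒴 Y ∧ HasResolution 𝒴 n K

/-- The class `𝒴^∧` of the objects having a finite `𝒴`-resolution. -/
def finiteRes (𝒴 : ObjectProperty C) : ObjectProperty C :=
  fun M => ∃ n : ℕ, HasResolution 𝒴 n M

/-- `K`, an acyclic complex `⋯ ⟶ K^{-1} ⟶ K^0 ⟶ K^1 ⟶ ⋯` with terms in `𝒳`, is a left complete
`(𝒳, 𝒴)`-resolution: the complex `Hom(K, Y)` of abelian groups is acyclic for all `Y ∈ 𝒴`. -/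
structure IsLeftCompleteResolution (𝒳 𝒴 : ObjectProperty C) (K : CochainComplex C ℤ) : Prop where
  acyclic : K.Acyclic
  mem : ∀ i : ℤ, 𝒳 (K.X i)
  hom_acyclic : ∀ Y : C, 𝒴 Y → ∀ (i : ℤ) (f : K.X i ⟶ Y), K.d (i - 1) i ≫ f = 0 →
    ∃ g : K.X (i + 1) ⟶ Y, K.d i (i + 1) ≫ g = f

/-- The class `𝒢𝒫_(𝒳, 𝒴)` of the `(𝒳, 𝒴)`-Gorenstein projective objects: the images
`Im (K^{-1} ⟶ K^0)` for the left complete `(𝒳, 𝒴)`-resolutions `K`. -/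
def gorensteinProjective (𝒳 𝒴 : ObjectProperty C) : ObjectProperty C :=
  fun M => ∃ K : CochainComplex C ℤ, IsLeftCompleteResolution 𝒳 𝒴 K ∧
    Nonempty (M ≅ image (K.d (-1) 0))

/-- Closed under kernels of epimorphisms between its objects. -/
def ClosedUnderKernelsOfEpis (𝒳 : ObjectProperty C) : Prop :=
  ∀ S : ShortComplex C, S.ShortExact → 𝒳 S.X₂ → 𝒳 S.X₃ → 𝒳 S.X₁

/-- Closed under cokernels of monomorphisms between its objects. -/
def ClosedUnderCokernelsOfMonos (𝒳 : ObjectProperty C) : Prop :=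
  ∀ S : ShortComplex C, S.ShortExact → 𝒳 S.X₁ → 𝒳 S.X₂ → 𝒳 S.X₃

/-- A left thick class: closed under extensions, kernels of epimorphisms between its objects, and
direct summands (in an abelian category, the retracts of an object are its direct summands). -/
structure IsLeftThick (𝒳 : ObjectProperty C) : Prop where
  extensions : 𝒳.IsClosedUnderExtensions
  kernels : ClosedUnderKernelsOfEpis 𝒳
  summands : 𝒳.IsStableUnderRetracts

/-- A right thick class: closed under extensions, cokernels of monomorphisms between its objects,
and direct summands. -/
structure IsRightThick (𝒳 : ObjectProperty C) : Prop where
  extensions : 𝒳.IsClosedUnderExtensions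
  cokernels : ClosedUnderCokernelsOfMonos 𝒳
  summands : 𝒳.IsStableUnderRetracts

section Pairs

variable [HasExt.{w} C]

/-- A weak GP-admissible pair `(𝒳, 𝒴)`. -/
structure IsWeakGPAdmissible (𝒳 𝒴 : ObjectProperty C) : Prop where
  pd_eq_zero : relPdClass.{w} 𝒴 𝒳 = 0
  epic : IsSelfEpic 𝒳

/-- A GP-admissible pair `(𝒳, 𝒴)`. Closure under finite coproducts includes the empty coproduct,
so that `0` lies in both classes, and closure under isomorphisms. -/
structure IsGPAdmissible (𝒳 𝒴 : ObjectProperty C) : Prop extends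
    IsWeakGPAdmissible.{w} 𝒳 𝒴 where
  left_coproducts : 𝒳.IsClosedUnderFiniteCoproducts
  right_coproducts : 𝒴.IsClosedUnderFiniteCoproducts
  left_extensions : 𝒳.IsClosedUnderExtensions
  cogenerator : IsRelativeCogenerator (𝒳 ⊓ 𝒴) 𝒳

/-- A left Frobenius pair `(𝒳, ω)`: `𝒳` is left thick, `ω` is closed under direct summands, and `ω`
is an `𝒳`-injective relative cogenerator in `𝒳`. -/
structure IsLeftFrobeniusPair (𝒳 ω : ObjectProperty C) : Prop where
  leftThick : IsLeftThick 𝒳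
  summands : ω.IsStableUnderRetracts
  injective : relIdClass.{w} 𝒳 ω = 0
  cogenerator : IsRelativeCogenerator ω 𝒳

end Pairs

end RelGorenstein

/-! The bilateral definition of a Gorenstein projective object collapses to a one-sided one: `M` is
in `𝒢𝒫_(𝒳, 𝒴)` iff it has a coresolution by `ω = 𝒳 ⊓ 𝒴` such that `M` and all cosyzygies are
Ext-orthogonal to `𝒴` (`gorensteinProjective_eq`). The left half of a complete resolution costs
nothing, because every object is a quotient of an object of `𝒳` and kernels of such epimorphisms
keep the vanishing. The right half can be moved from `𝒳` into `ω` by means of the cogenerator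
(`IsCoresolved.of_cogenerator`). Since Ext from cosyzygies into `ω ≤ 𝒴` vanishes, a horseshoe
argument shows that this class is left thick, whence (a).

An object of `𝒢𝒫` that also lies in `𝒴^∧` embeds in some `W ∈ ω` with a cokernel `N ∈ 𝒢𝒫`; the
sequence splits because `Ext¹(N, 𝒴^∧) = 0`. This gives (c), the intersections in (d) and the
retracts in (b). The closure of `𝒴^∧` under summands in (b) is Auslander–Buchweitz theory for the
left Frobenius pair `(𝒢𝒫, 𝒴)`. -/

namespace RelGorenstein

variable {C : Type u} [Category.{v} C] [Abelian C]

/-! ### Operations on short exact sequences -/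

/-- There is a short exact sequence `0 ⟶ A ⟶ B ⟶ D ⟶ 0`. -/
def IsSES (A B D : C) : Prop :=
  ∃ (i : A ⟶ B) (p : B ⟶ D) (h : i ≫ p = 0), (ShortComplex.mk i p h).ShortExact

lemma isSES_of_shortExact {S : ShortComplex C} (hS : S.ShortExact) : IsSES S.X₁ S.X₂ S.X₃ :=
  ⟨S.f, S.g, S.zero, hS⟩

lemma isSES_cokernel {A B : C} (f : A ⟶ B) [Mono f] : IsSES A B (cokernel f) :=
  ⟨f, cokernel.π f, cokernel.condition f,
    { exact := ShortComplex.exact_cokernel f }⟩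

lemma isSES_kernel {B D : C} (g : B ⟶ D) [Epi g] : IsSES (kernel g) B D :=
  ⟨kernel.ι g, g, kernel.condition g,
    { exact := ShortComplex.exact_kernel g }⟩

lemma IsSES.of_iso {A B D A' B' D' : C} (h : IsSES A B D) (a : A ≅ A') (b : B ≅ B') (d : D ≅ D') :
    IsSES A' B' D' := by
  obtain ⟨i, p, w, hS⟩ := h
  refine ⟨a.inv ≫ i ≫ b.hom, b.inv ≫ p ≫ d.hom, by simp [reassoc_of% w], ?_⟩
  exact ShortComplex.shortExact_of_iso (ShortComplex.isoMk a b d (by simp) (by simp)) hS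

/-- The third term of a short exact sequence is a cokernel of its monomorphism. -/
noncomputable def cokernelIsoOfShortExact {S : ShortComplex C} (hS : S.ShortExact) :
    cokernel S.f ≅ S.X₃ :=
  (cokernelIsCokernel S.f).coconePointUniqueUpToIso hS.gIsCokernel

/-- The first term of a short exact sequence is a kernel of its epimorphism. -/
noncomputable def kernelIsoOfShortExact {S : ShortComplex C} (hS : S.ShortExact) :
    kernel S.g ≅ S.X₁ :=
  (kernelIsKernel S.g).conePointUniqueUpToIso hS.fIsKernel

lemma isSES_of_mono {A B D : C} (f : A ⟶ B) [Mono f] (e : cokernel f ≅ D) : IsSES A B D :=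
  (isSES_cokernel f).of_iso (Iso.refl _) (Iso.refl _) e

lemma isSES_of_epi {A B D : C} (g : B ⟶ D) [Epi g] (e : kernel g ≅ A) : IsSES A B D :=
  (isSES_kernel g).of_iso e (Iso.refl _) (Iso.refl _)

lemma isSES_biprod (A B : C) : IsSES A (A ⊞ B) B :=
  isSES_of_shortExact (ShortComplex.Splitting.ofHasBinaryBiproduct A B).shortExact

lemma isSES_zero_left {Z : C} (hZ : IsZero Z) (A : C) : IsSES Z A A :=
  (isSES_biprod Z A).of_iso (Iso.refl _)
    ⟨biprod.snd, biprod.inr, by ext <;> simp [hZ.eq_of_src _ (0 : Z ⟶ _)], by simp⟩ (Iso.refl _)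

lemma isSES_zero_right {Z : C} (hZ : IsZero Z) (A : C) : IsSES A A Z :=
  (isSES_biprod A Z).of_iso (Iso.refl _)
    ⟨biprod.fst, biprod.inl, by ext <;> simp [hZ.eq_of_src _ (0 : Z ⟶ _)], by simp⟩ (Iso.refl _)

/-- Pushout of a short exact sequence along a monomorphism. -/
lemma IsSES.pushout {A B D A₁ A₂ : C} (h : IsSES A B D) (h' : IsSES A A₁ A₂) :
    ∃ E, IsSES A₁ E D ∧ IsSES B E A₂ := by
  obtain ⟨i, p, w, hS⟩ := h
  obtain ⟨j, q, w', hS'⟩ := h'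
  have : Mono i := hS.mono_f
  have : Mono j := hS'.mono_f
  have sq := IsPushout.of_hasPushout i j
  have := isIso_cokernel_map_of_isPushout sq
  have := isIso_cokernel_map_of_isPushout sq.flip
  exact ⟨Limits.pushout i j,
    isSES_of_mono (pushout.inr i j) ((asIso (cokernel.map _ _ _ _ sq.w)).symm ≪≫
      cokernelIsoOfShortExact hS),
    isSES_of_mono (pushout.inl i j) ((asIso (cokernel.map _ _ _ _ sq.flip.w)).symm ≪≫
      cokernelIsoOfShortExact hS')⟩

/-- Pullback of a short exact sequence along an epimorphism. -/
lemma IsSES.pullback {A B D B₁ B₂ : C} (h : IsSES A B D) (h' : IsSES B₁ B₂ D) :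
    ∃ E, IsSES A E B₂ ∧ IsSES B₁ E B := by
  obtain ⟨i, p, w, hS⟩ := h
  obtain ⟨j, q, w', hS'⟩ := h'
  have : Epi p := hS.epi_g
  have : Epi q := hS'.epi_g
  have sq := IsPullback.of_hasPullback p q
  have := isIso_kernel_map_of_isPullback sq
  have := isIso_kernel_map_of_isPullback sq.flip
  exact ⟨Limits.pullback p q,
    isSES_of_epi (pullback.snd p q) ((asIso (kernel.map _ _ _ _ sq.flip.w)) ≪≫
      kernelIsoOfShortExact hS),
    isSES_of_epi (pullback.fst p q) ((asIso (kernel.map _ _ _ _ sq.w)) ≪≫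
      kernelIsoOfShortExact hS')⟩

/-- The cokernel of a composition of monomorphisms. -/
lemma IsSES.comp_mono {A B D E F : C} (h : IsSES A B D) (h' : IsSES B E F) :
    ∃ Q, IsSES A E Q ∧ IsSES D Q F := by
  obtain ⟨i, p, w, hS⟩ := h
  obtain ⟨j, q, w', hS'⟩ := h'
  have : Mono i := hS.mono_f
  have : Mono j := hS'.mono_f
  have := kernelCokernelCompSequence_exact i j
  refine ⟨cokernel (i ≫ j), isSES_cokernel _, ?_⟩
  refine IsSES.of_iso (A := cokernel i) (B := cokernel (i ≫ j)) (D := cokernel j) ?_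
    (cokernelIsoOfShortExact hS) (Iso.refl _) (cokernelIsoOfShortExact hS')
  have hm : Mono (cokernel.map i (i ≫ j) (𝟙 _) j (by simp)) :=
    (this.exact 2).mono_g ((isZero_kernel_of_mono j).eq_of_src _ _)
  have he : Epi (cokernel.map (i ≫ j) j i (𝟙 _) (by simp)) := inferInstance
  exact ⟨_, _, _, { exact := this.exact 3, mono_f := hm, epi_g := he }⟩

/-- The kernel of a composition of epimorphisms. -/
lemma IsSES.comp_epi {A B D E F : C} (h : IsSES A B D) (h' : IsSES E D F) :
    ∃ Q, IsSES Q B F ∧ IsSES A Q E := by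
  obtain ⟨i, p, w, hS⟩ := h
  obtain ⟨j, q, w', hS'⟩ := h'
  have : Epi p := hS.epi_g
  have : Epi q := hS'.epi_g
  have := kernelCokernelCompSequence_exact p q
  refine ⟨kernel (p ≫ q), isSES_kernel _, ?_⟩
  refine IsSES.of_iso (A := kernel p) (B := kernel (p ≫ q)) (D := kernel q) ?_
    (kernelIsoOfShortExact hS) (Iso.refl _) (kernelIsoOfShortExact hS')
  have he : Epi (kernel.map (p ≫ q) q p (𝟙 _) (by simp)) :=
    (this.exact 1).epi_f ((isZero_cokernel_of_epi p).eq_of_tgt _ _)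
  have hm : Mono (kernel.map p (p ≫ q) (𝟙 _) q (by simp)) := inferInstance
  exact ⟨_, _, _, { exact := this.exact 0, mono_f := hm, epi_g := he }⟩

/-- The direct sum of two short exact sequences. -/
lemma IsSES.biprod {A B D A' B' D' : C} (h : IsSES A B D) (h' : IsSES A' B' D') :
    IsSES (A ⊞ A') (B ⊞ B') (D ⊞ D') := by
  obtain ⟨i, p, w, hS⟩ := h
  obtain ⟨j, q, w', hS'⟩ := h'
  have : Mono i := hS.mono_f
  have : Mono j := hS'.mono_f
  have : Epi p := hS.epi_g
  have : Epi q := hS'.epi_g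
  refine ⟨biprod.map i j, biprod.map p q, by ext <;> simp [w, w'],
    { exact := ?_, mono_f := ?_, epi_g := ?_ }⟩
  · refine ShortComplex.exact_of_f_is_kernel _ (KernelFork.IsLimit.ofι' _ _ fun {T} k hk ↦ ?_)
    dsimp at k hk
    have h₁ : (k ≫ biprod.fst) ≫ p = 0 := by
      simpa using hk =≫ biprod.fst
    have h₂ : (k ≫ biprod.snd) ≫ q = 0 := by
      simpa using hk =≫ biprod.snd
    refine ⟨biprod.lift (hS.exact.lift _ h₁) (hS'.exact.lift _ h₂), ?_⟩
    ext
    · simpa using hS.exact.lift_f _ h₁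
    · simpa using hS'.exact.lift_f _ h₂
  · dsimp; infer_instance
  · dsimp; infer_instance

/-- Add a direct summand to the first two terms of a short exact sequence. -/
lemma IsSES.add_left {A B D : C} (h : IsSES A B D) (M : C) : IsSES (M ⊞ A) (M ⊞ B) D := by
  obtain ⟨Z, hZ⟩ := HasZeroObject.zero (C := C)
  exact ((isSES_zero_right hZ M).biprod h).of_iso (Iso.refl _) (Iso.refl _)
    ⟨biprod.snd, biprod.inr, by ext <;> simp [hZ.eq_of_src _ (0 : Z ⟶ _)], by simp⟩

lemma exists_iso_biprod_of_retract {M N : C} (r : Retract M N) : ∃ M', Nonempty (N ≅ M ⊞ M') := by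
  exact ⟨cokernel r.i, ⟨(ShortComplex.Splitting.ofExactOfRetraction
    (ShortComplex.mk r.i (cokernel.π r.i) (cokernel.condition _))
    (ShortComplex.exact_cokernel _) r.r r.retract inferInstance).isoBinaryBiproduct⟩⟩

end RelGorenstein

/-! ### Vanishing of Ext and splitting -/

namespace RelGorenstein

variable {C : Type u} [Category.{v} C] [Abelian C] [HasExt.{w} C]

open Abelian

lemma IsSES.subsingleton_ext_left {A B D : C} (h : IsSES A B D) {N : C} {n : ℕ}
    (hB : Subsingleton (Ext.{w} B N n)) (hD : Subsingleton (Ext.{w} D N (n + 1))) :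
    Subsingleton (Ext.{w} A N n) := by
  obtain ⟨i, p, w, hS⟩ := h
  refine subsingleton_of_forall_eq 0 fun x ↦ ?_
  obtain ⟨y, rfl⟩ := Ext.contravariant_sequence_exact₁ hS N x (add_comm 1 n) (hD.elim _ _)
  rw [hB.elim y 0, Ext.comp_zero]

lemma IsSES.subsingleton_ext_middle {A B D : C} (h : IsSES A B D) {N : C} {n : ℕ}
    (hA : Subsingleton (Ext.{w} A N n)) (hD : Subsingleton (Ext.{w} D N n)) :
    Subsingleton (Ext.{w} B N n) := by
  obtain ⟨i, p, w, hS⟩ := h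
  refine subsingleton_of_forall_eq 0 fun x ↦ ?_
  obtain ⟨y, rfl⟩ := Ext.contravariant_sequence_exact₂ hS N x (hA.elim _ _)
  rw [hD.elim y 0, Ext.comp_zero]

lemma IsSES.subsingleton_ext_right {A B D : C} (h : IsSES A B D) {N : C} {n : ℕ}
    (hA : Subsingleton (Ext.{w} A N n)) (hB : Subsingleton (Ext.{w} B N (n + 1))) :
    Subsingleton (Ext.{w} D N (n + 1)) := by
  obtain ⟨i, p, w, hS⟩ := h
  refine subsingleton_of_forall_eq 0 fun x ↦ ?_
  obtain ⟨y, rfl⟩ := Ext.contravariant_sequence_exact₃ hS N x (hB.elim _ _) (add_comm 1 n)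
  rw [hA.elim y 0, Ext.comp_zero]

lemma IsSES.subsingleton_ext_middle' {A B D : C} (h : IsSES A B D) {M : C} {n : ℕ}
    (hA : Subsingleton (Ext.{w} M A n)) (hD : Subsingleton (Ext.{w} M D n)) :
    Subsingleton (Ext.{w} M B n) := by
  obtain ⟨i, p, w, hS⟩ := h
  refine subsingleton_of_forall_eq 0 fun x ↦ ?_
  obtain ⟨y, rfl⟩ := Ext.covariant_sequence_exact₂ M hS x (hD.elim _ _)
  rw [hA.elim y 0, Ext.zero_comp]

lemma IsSES.subsingleton_ext_right' {A B D : C} (h : IsSES A B D) {M : C} {n : ℕ}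
    (hA : Subsingleton (Ext.{w} M A (n + 1))) (hB : Subsingleton (Ext.{w} M B n)) :
    Subsingleton (Ext.{w} M D n) := by
  obtain ⟨i, p, w, hS⟩ := h
  refine subsingleton_of_forall_eq 0 fun x ↦ ?_
  obtain ⟨y, rfl⟩ := Ext.covariant_sequence_exact₃ M hS x rfl (hA.elim _ _)
  rw [hB.elim y 0, Ext.zero_comp]

/-- If `Hom(B, N) ⟶ Hom(A, N)` is surjective and `Ext¹(B, N) = 0`, then `Ext¹(D, N) = 0`. -/
lemma subsingleton_ext_one_of_extension {S : ShortComplex C} (hS : S.ShortExact) {N : C}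
    (hB : Subsingleton (Ext.{w} S.X₂ N 1))
    (H : ∀ f : S.X₁ ⟶ N, ∃ g : S.X₂ ⟶ N, S.f ≫ g = f) :
    Subsingleton (Ext.{w} S.X₃ N 1) := by
  refine subsingleton_of_forall_eq 0 fun x ↦ ?_
  obtain ⟨y, rfl⟩ := Ext.contravariant_sequence_exact₃ hS N x (hB.elim _ _) (add_zero 1)
  obtain ⟨f, rfl⟩ := (Ext.mk₀_bijective _ _).2 y
  obtain ⟨g, rfl⟩ := H f
  rw [← Ext.mk₀_comp_mk₀, hS.extClass_comp_assoc]

/-- Morphisms to `N` extend along a monomorphism whose cokernel has no extensions by `N`. -/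
lemma exists_extension_of_subsingleton_ext {S : ShortComplex C} (hS : S.ShortExact) {N : C}
    (h : Subsingleton (Ext.{w} S.X₃ N 1)) (f : S.X₁ ⟶ N) : ∃ g : S.X₂ ⟶ N, S.f ≫ g = f := by
  obtain ⟨y, hy⟩ := Ext.contravariant_sequence_exact₁ hS N (Ext.mk₀ f) (add_zero 1) (h.elim _ _)
  obtain ⟨g, rfl⟩ := (Ext.mk₀_bijective _ _).2 y
  exact ⟨g, (Ext.mk₀_bijective _ _).1 (by simpa using hy)⟩

lemma IsSES.split {A B D : C} (h : IsSES A B D) (hE : Subsingleton (Ext.{w} D A 1)) :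
    Nonempty (B ≅ A ⊞ D) := by
  obtain ⟨i, p, w, hS⟩ := h
  obtain ⟨r, hr⟩ := exists_extension_of_subsingleton_ext hS hE (𝟙 A)
  exact ⟨(ShortComplex.Splitting.ofExactOfRetraction _ hS.exact r hr hS.epi_g).isoBinaryBiproduct⟩

lemma IsSES.retract_of_subsingleton_ext {A B D : C} (h : IsSES A B D)
    (hE : Subsingleton (Ext.{w} D A 1)) : Nonempty (Retract A B) := by
  obtain ⟨i, p, w, hS⟩ := h
  obtain ⟨r, hr⟩ := exists_extension_of_subsingleton_ext hS hE (𝟙 A)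
  exact ⟨⟨i, r, hr⟩⟩

lemma subsingleton_ext_of_retract {M N : C} (r : Retract M N) {Y : C} {n : ℕ}
    (h : Subsingleton (Ext.{w} N Y n)) : Subsingleton (Ext.{w} M Y n) := by
  refine subsingleton_of_forall_eq 0 fun x ↦ ?_
  rw [← Ext.mk₀_id_comp x, ← r.retract, ← Ext.mk₀_comp_mk₀_assoc,
    h.elim ((Ext.mk₀ r.r).comp x (zero_add n)) 0, Ext.comp_zero]

lemma subsingleton_ext_of_retract' {M N : C} (r : Retract M N) {X : C} {n : ℕ}
    (h : Subsingleton (Ext.{w} X N n)) : Subsingleton (Ext.{w} X M n) := by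
  refine subsingleton_of_forall_eq 0 fun x ↦ ?_
  have : (x.comp (Ext.mk₀ r.i) (add_zero n)).comp (Ext.mk₀ r.r) (add_zero n) = x := by
    rw [Ext.comp_assoc_of_third_deg_zero, Ext.mk₀_comp_mk₀, r.retract, Ext.comp_mk₀_id]
  rw [← this, h.elim (x.comp (Ext.mk₀ r.i) (add_zero n)) 0, Ext.zero_comp]

/-- All the groups `Ext^j(M, N)` vanish for `j > 0`. -/
def ExtVanish (M N : C) : Prop := ∀ n : ℕ, Subsingleton (Ext.{w} M N (n + 1))

/-- `Ext^j(X, Y) = 0` for all `j > 0`, `X ∈ 𝒳`, `Y ∈ 𝒴`. -/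
def ExtOrthogonal (𝒳 𝒴 : ObjectProperty C) : Prop :=
  ∀ X Y : C, 𝒳 X → 𝒴 Y → ExtVanish.{w} X Y

lemma relPd_eq_zero_iff (𝒴 : ObjectProperty C) (M : C) :
    relPd.{w} 𝒴 M = 0 ↔ ∀ Y, 𝒴 Y → ExtVanish.{w} M Y := by
  constructor
  · intro h Y hY n
    -- The infimum of the empty set in `ℕ∞` is `⊤`, so the value `0` forces the set to be nonempty
    -- and hence to contain its infimum.
    have hne : {d : ℕ∞ | ∃ n : ℕ, d = n ∧
        ∀ j : ℕ, n < j → ∀ Y : C, 𝒴 Y → Subsingleton (Ext.{w} M Y j)}.Nonempty := by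
      by_contra hne
      rw [Set.not_nonempty_iff_eq_empty] at hne
      rw [relPd, hne, sInf_empty] at h
      exact absurd h (by simp)
    obtain ⟨m, hm, H⟩ := csInf_mem hne
    have : m = 0 := by
      have h' := hm.symm.trans h
      exact_mod_cast h'
    subst this
    exact H _ (Nat.succ_pos n) Y hY
  · intro h
    refine le_antisymm (csInf_le' ⟨0, by simp, fun j hj Y hY ↦ ?_⟩) zero_le
    obtain ⟨n, rfl⟩ := Nat.exists_eq_succ_of_ne_zero hj.ne'
    exact h Y hY n

lemma relId_eq_zero_iff (𝒳 : ObjectProperty C) (M : C) :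
    relId.{w} 𝒳 M = 0 ↔ ∀ X, 𝒳 X → ExtVanish.{w} X M := by
  constructor
  · intro h X hX n
    have hne : {d : ℕ∞ | ∃ n : ℕ, d = n ∧
        ∀ j : ℕ, n < j → ∀ X : C, 𝒳 X → Subsingleton (Ext.{w} X M j)}.Nonempty := by
      by_contra hne
      rw [Set.not_nonempty_iff_eq_empty] at hne
      rw [relId, hne, sInf_empty] at h
      exact absurd h (by simp)
    obtain ⟨m, hm, H⟩ := csInf_mem hne
    have : m = 0 := by
      have h' := hm.symm.trans h
      exact_mod_cast h'
    subst this
    exact H _ (Nat.succ_pos n) X hX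
  · intro h
    refine le_antisymm (csInf_le' ⟨0, by simp, fun j hj X hX ↦ ?_⟩) zero_le
    obtain ⟨n, rfl⟩ := Nat.exists_eq_succ_of_ne_zero hj.ne'
    exact h X hX n

lemma relPdClass_eq_zero_iff (𝒴 𝒳 : ObjectProperty C) :
    relPdClass.{w} 𝒴 𝒳 = 0 ↔ ExtOrthogonal.{w} 𝒳 𝒴 := by
  simp only [relPdClass, ENat.iSup_eq_zero, relPd_eq_zero_iff]
  exact ⟨fun h X Y hX hY ↦ h X hX Y hY, fun h X hX Y hY ↦ h X Y hX hY⟩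

lemma relIdClass_eq_zero_iff (𝒳 𝒴 : ObjectProperty C) :
    relIdClass.{w} 𝒳 𝒴 = 0 ↔ ExtOrthogonal.{w} 𝒳 𝒴 := by
  simp only [relIdClass, ENat.iSup_eq_zero, relId_eq_zero_iff]
  exact ⟨fun h X Y hX hY ↦ h Y hY X hX, fun h Y hY X hX ↦ h X Y hX hY⟩

end RelGorenstein

/-! ### Acyclic complexes as spliced short exact sequences -/

namespace RelGorenstein

variable {C : Type u} [Category.{v} C] [Abelian C]

lemma shortExact_image_of_acyclic {K : CochainComplex C ℤ} (hK : K.Acyclic) {a b c : ℤ}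
    (hab : a + 1 = b) (hbc : b + 1 = c) :
    ∃ h : image.ι (K.d a b) ≫ factorThruImage (K.d b c) = 0,
      (ShortComplex.mk (image.ι (K.d a b)) (factorThruImage (K.d b c)) h).ShortExact := by
  have h₀ : K.d a b ≫ factorThruImage (K.d b c) = 0 := by
    rw [← cancel_mono (image.ι (K.d b c))]
    simp
  have h : image.ι (K.d a b) ≫ factorThruImage (K.d b c) = 0 := by
    rw [← cancel_epi (factorThruImage (K.d a b))]
    simpa using h₀
  refine ⟨h, { exact := ?_ }⟩
  have hE : (ShortComplex.mk (K.d a b) (K.d b c) (K.d_comp_d _ _ _)).Exact :=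
    (K.exactAt_iff' a b c (by subst hab; simp) (by subst hbc; simp)).1 (hK b)
  -- Exactness in the middle is insensitive to a monomorphism on the right term (`φ`) and an
  -- epimorphism on the left term (`ψ`); together they replace both differentials by their images.
  let φ : ShortComplex.mk (K.d a b) (factorThruImage (K.d b c)) h₀ ⟶
      ShortComplex.mk (K.d a b) (K.d b c) (K.d_comp_d _ _ _) :=
    { τ₁ := 𝟙 _, τ₂ := 𝟙 _, τ₃ := image.ι _ }
  let ψ : ShortComplex.mk (K.d a b) (factorThruImage (K.d b c)) h₀ ⟶
      ShortComplex.mk (image.ι (K.d a b)) (factorThruImage (K.d b c)) h :=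
    { τ₁ := factorThruImage _, τ₂ := 𝟙 _, τ₃ := 𝟙 _ }
  have : Mono φ.τ₃ := by dsimp [φ]; infer_instance
  have : Epi ψ.τ₁ := by dsimp [ψ]; infer_instance
  have : IsIso φ.τ₂ := by dsimp [φ]; infer_instance
  have : IsIso ψ.τ₂ := by dsimp [ψ]; infer_instance
  have : Epi φ.τ₁ := by dsimp [φ]; infer_instance
  have : Mono ψ.τ₃ := by dsimp [ψ]; infer_instance
  exact (ShortComplex.exact_iff_of_epi_of_isIso_of_mono ψ).1
    ((ShortComplex.exact_iff_of_epi_of_isIso_of_mono φ).2 hE)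

section Splice

variable {Z X : ℤ → C} (i : ∀ n, Z n ⟶ X n) (p : ∀ n, X n ⟶ Z (n + 1)) (w : ∀ n, i n ≫ p n = 0)

/-- The complex obtained by splicing a `ℤ`-indexed family of short exact sequences
`0 ⟶ Z n ⟶ X n ⟶ Z (n + 1) ⟶ 0`. -/
noncomputable def splice : CochainComplex C ℤ :=
  CochainComplex.of X (fun n ↦ p n ≫ i (n + 1)) (fun n ↦ by simp [reassoc_of% w])

lemma splice_d (n : ℤ) : (splice i p w).d n (n + 1) = p n ≫ i (n + 1) :=
  CochainComplex.of_d X (fun n ↦ p n ≫ i (n + 1)) n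

variable (hS : ∀ n, (ShortComplex.mk (i n) (p n) (w n)).ShortExact)

include hS

lemma splice_acyclic : (splice i p w).Acyclic := by
  intro n
  obtain ⟨m, rfl⟩ : ∃ m, n = m + 1 := ⟨n - 1, by simp⟩
  rw [HomologicalComplex.exactAt_iff' _ m (m + 1) (m + 1 + 1) (by simp) (by simp)]
  have h₀ : (p m ≫ i (m + 1)) ≫ p (m + 1) = 0 := by simp [w]
  have h₁ : (p m ≫ i (m + 1)) ≫ p (m + 1) ≫ i (m + 1 + 1) = 0 := by simp [reassoc_of% w]
  have := (hS m).epi_g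
  have := (hS (m + 1 + 1)).mono_f
  let φ : ShortComplex.mk (p m ≫ i (m + 1)) (p (m + 1)) h₀ ⟶
      ShortComplex.mk (p m ≫ i (m + 1)) (p (m + 1) ≫ i (m + 1 + 1)) h₁ :=
    { τ₁ := 𝟙 _, τ₂ := 𝟙 _, τ₃ := i _ }
  let ψ : ShortComplex.mk (p m ≫ i (m + 1)) (p (m + 1)) h₀ ⟶
      ShortComplex.mk (i (m + 1)) (p (m + 1)) (w _) :=
    { τ₁ := p m, τ₂ := 𝟙 _, τ₃ := 𝟙 _ }
  have : Mono φ.τ₃ := by dsimp [φ]; assumption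
  have : Epi ψ.τ₁ := by dsimp [ψ]; assumption
  have : IsIso φ.τ₂ := by dsimp [φ]; infer_instance
  have : IsIso ψ.τ₂ := by dsimp [ψ]; infer_instance
  have : Epi φ.τ₁ := by dsimp [φ]; infer_instance
  have : Mono ψ.τ₃ := by dsimp [ψ]; infer_instance
  have hE := (ShortComplex.exact_iff_of_epi_of_isIso_of_mono φ).1
    ((ShortComplex.exact_iff_of_epi_of_isIso_of_mono ψ).2 (hS (m + 1)).exact)
  convert hE using 1
  dsimp only [HomologicalComplex.sc', HomologicalComplex.shortComplexFunctor']
  congr 1 <;> exact splice_d i p w _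

lemma splice_image {a b : ℤ} (hab : a + 1 = b) :
    Nonempty (Z b ≅ image ((splice i p w).d a b)) := by
  subst hab
  have : Epi (p a) := (hS a).epi_g
  have : Mono (i (a + 1)) := (hS (a + 1)).mono_f
  have : StrongEpi (p a) := strongEpi_of_epi _
  exact ⟨image.isoStrongEpiMono (p a) (i (a + 1)) rfl ≪≫
    eqToIso (congrArg (fun f : X a ⟶ X (a + 1) ↦ image f) (splice_d i p w a).symm)⟩

/-- As `p a` is epi, `f` kills the cycle object `Z (a + 1)`, so it descends to `Z (a + 1 + 1)`, from
where `H` extends it. -/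
lemma exists_extension_of_spliced {Y : C} (H : ∀ n (f : Z n ⟶ Y), ∃ g, i n ≫ g = f) {a : ℤ}
    (f : X (a + 1) ⟶ Y) (hf : p a ≫ i (a + 1) ≫ f = 0) :
    ∃ g : X (a + 1 + 1) ⟶ Y, (p (a + 1) ≫ i (a + 1 + 1)) ≫ g = f := by
  have : Epi (p a) := (hS a).epi_g
  have hE := hS (a + 1)
  have : Epi (p (a + 1)) := hE.epi_g
  have : Epi (ShortComplex.mk (i (a + 1)) (p (a + 1)) (w _)).g := this
  have hf' : i (a + 1) ≫ f = 0 := by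
    rw [← cancel_epi (p a), hf, comp_zero]
  obtain ⟨g, hg⟩ := H _ (hE.exact.desc f hf')
  exact ⟨g, by rw [Category.assoc, hg]; exact hE.exact.g_desc f hf'⟩

lemma splice_hom_acyclic {Y : C} (H : ∀ n (f : Z n ⟶ Y), ∃ g, i n ≫ g = f) {a b c : ℤ}
    (hab : a + 1 = b) (hbc : b + 1 = c) (f : (splice i p w).X b ⟶ Y)
    (hf : (splice i p w).d a b ≫ f = 0) :
    ∃ g : (splice i p w).X c ⟶ Y, (splice i p w).d b c ≫ g = f := by
  subst hab hbc
  rw [splice_d] at hf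
  rw [splice_d]
  exact exists_extension_of_spliced i p w hS H f ((Category.assoc _ _ _).symm.trans hf)

end Splice

/-- Extending an element to a `ℤ`-indexed chain of a relation. -/
lemma exists_int_chain {α : Type*} (r : α → α → Prop) (P Q : α → Prop)
    (hP : ∀ x, P x → ∃ y, r x y ∧ P y) (hQ : ∀ x, Q x → ∃ y, r y x ∧ Q y) (x : α)
    (hx : P x) (hx' : Q x) : ∃ Z : ℤ → α, Z 0 = x ∧ ∀ n, r (Z n) (Z (n + 1)) := by
  choose f hf hf' using hP
  choose g hg hg' using hQ
  let u : ℕ → { y // P y } := fun n ↦ Nat.rec ⟨x, hx⟩ (fun _ y ↦ ⟨f y.1 y.2, hf' y.1 y.2⟩) n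
  let v : ℕ → { y // Q y } := fun n ↦ Nat.rec ⟨x, hx'⟩ (fun _ y ↦ ⟨g y.1 y.2, hg' y.1 y.2⟩) n
  -- The two chains share `x` at position `0`; since `Int.negSucc n` is `-(n + 1)`, it takes `v (n +
  -- 1)`, and the step from `-1` to `0` is a case of its own.
  refine ⟨fun n ↦ match n with
    | Int.ofNat n => (u n).1
    | Int.negSucc n => (v (n + 1)).1, rfl, ?_⟩
  rintro (n | _ | n)
  · exact hf _ (u n).2
  · exact hg x hx'
  · exact hg _ (v (n + 1)).2

/-! ### Coresolved objects and complete resolutions -/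

variable [HasExt.{w} C]

/-- The objects `M` with `Ext^j(M, 𝒴) = 0` for `j > 0` admitting an infinite coresolution
`0 ⟶ M ⟶ W^0 ⟶ W^1 ⟶ ⋯` by objects of `𝒲`, all of whose cosyzygies have the same
vanishing property. -/
def IsCoresolved (𝒲 𝒴 : ObjectProperty C) : ObjectProperty C :=
  fun M => ∃ P : ObjectProperty C, P M ∧ ∀ N, P N →
    (∀ Y, 𝒴 Y → ExtVanish.{w} N Y) ∧ ∃ W N', 𝒲 W ∧ P N' ∧ IsSES N W N'

namespace IsCoresolved

variable {𝒲 𝒴 : ObjectProperty C}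

lemma orthogonal : ExtOrthogonal.{w} (IsCoresolved.{w} 𝒲 𝒴) 𝒴 := by
  rintro M Y ⟨P, hM, hP⟩ hY
  exact (hP M hM).1 Y hY

lemma exists_isSES {M : C} (hM : IsCoresolved.{w} 𝒲 𝒴 M) :
    ∃ W N, 𝒲 W ∧ IsCoresolved.{w} 𝒲 𝒴 N ∧ IsSES M W N := by
  obtain ⟨P, hM, hP⟩ := hM
  obtain ⟨W, N, hW, hN, h⟩ := (hP M hM).2
  exact ⟨W, N, hW, ⟨P, hN, hP⟩, h⟩

/-- An object with an embedding into `𝒲` whose cokernel is coresolved is coresolved. -/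
lemma of_isSES {M W N : C} (h : IsSES M W N) (hW : 𝒲 W) (hN : IsCoresolved.{w} 𝒲 𝒴 N)
    (hM : ∀ Y, 𝒴 Y → ExtVanish.{w} M Y) : IsCoresolved.{w} 𝒲 𝒴 M := by
  refine ⟨fun A ↦ A = M ∨ IsCoresolved.{w} 𝒲 𝒴 A, Or.inl rfl, ?_⟩
  rintro _ (rfl | hA)
  · exact ⟨hM, W, N, hW, Or.inr hN, h⟩
  · obtain ⟨W, N, hW, hN, h⟩ := hA.exists_isSES
    exact ⟨fun Y hY ↦ orthogonal _ _ hA hY, W, N, hW, Or.inr hN, h⟩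

lemma mono {𝒲' 𝒴' : ObjectProperty C} (h : 𝒲 ≤ 𝒲') (h' : 𝒴' ≤ 𝒴) :
    IsCoresolved.{w} 𝒲 𝒴 ≤ IsCoresolved.{w} 𝒲' 𝒴' := by
  rintro M ⟨P, hM, hP⟩
  refine ⟨P, hM, fun N hN ↦ ?_⟩
  obtain ⟨h₁, W, N', hW, hN', hS⟩ := hP N hN
  exact ⟨fun Y hY ↦ h₁ Y (h' _ hY), W, N', h _ hW, hN', hS⟩

end IsCoresolved

/-- The cosyzygies are the images of the differentials. Acyclicity of `Hom(K, Y)` extends maps from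
each image to the next term, which kills `Ext¹`; higher degrees follow by shifting along `K`. -/
lemma gorensteinProjective_le {𝒳 𝒴 : ObjectProperty C} (h : ExtOrthogonal.{w} 𝒳 𝒴) :
    gorensteinProjective 𝒳 𝒴 ≤ IsCoresolved.{w} 𝒳 𝒴 := by
  rintro M ⟨K, hK, ⟨e⟩⟩
  have key (Y : C) (hY : 𝒴 Y) (n : ℕ) : ∀ b c : ℤ, b + 1 = c →
      Subsingleton (Abelian.Ext.{w} (image (K.d b c)) Y (n + 1)) := by
    induction n with
    | zero =>
      rintro b c hbc
      obtain ⟨a, hab⟩ : ∃ a, a + 1 = b := ⟨b - 1, by simp⟩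
      obtain ⟨w, hS⟩ := shortExact_image_of_acyclic hK.acyclic hab hbc
      refine subsingleton_ext_one_of_extension hS (h _ _ (hK.mem _) hY 0) fun f ↦ ?_
      obtain ⟨a', haa'⟩ : ∃ a', a' + 1 = a := ⟨a - 1, by simp⟩
      subst hab haa'
      -- Precomposing `f` with the projection onto the image gives a cocycle of `Hom(K, Y)`; a
      -- primitive of it extends `f`.
      have := hK.hom_acyclic Y hY (a' + 1) (factorThruImage (K.d (a' + 1) (a' + 1 + 1)) ≫ f) (by
        obtain ⟨w', -⟩ := shortExact_image_of_acyclic hK.acyclic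
          (show a' + 1 - 1 + 1 = a' + 1 by simp) (show a' + 1 + 1 = a' + 1 + 1 from rfl)
        rw [← image.fac (K.d (a' + 1 - 1) (a' + 1)), Category.assoc, reassoc_of% w']
        simp)
      obtain ⟨g, hg⟩ := this
      refine ⟨g, ?_⟩
      dsimp
      rw [← cancel_epi (factorThruImage (K.d (a' + 1) (a' + 1 + 1))), ← hg, image.fac_assoc]
    | succ n ih =>
      rintro b c hbc
      obtain ⟨a, hab⟩ : ∃ a, a + 1 = b := ⟨b - 1, by simp⟩
      obtain ⟨w, hS⟩ := shortExact_image_of_acyclic hK.acyclic hab hbc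
      exact (isSES_of_shortExact hS).subsingleton_ext_right (ih a b hab)
        (h _ _ (hK.mem _) hY (n + 1))
  refine ⟨fun N ↦ ∃ a b : ℤ, a + 1 = b ∧ Nonempty (N ≅ image (K.d a b)),
    ⟨-1, 0, by simp, ⟨e⟩⟩, ?_⟩
  rintro N ⟨a, b, hab, ⟨e⟩⟩
  obtain ⟨w, hS⟩ := shortExact_image_of_acyclic hK.acyclic hab rfl
  exact ⟨fun Y hY n ↦ subsingleton_ext_of_retract e.retract (key Y hY n a b hab),
    _, _, hK.mem b, ⟨b, b + 1, rfl, ⟨Iso.refl _⟩⟩,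
    (isSES_of_shortExact hS).of_iso e.symm (Iso.refl _) (Iso.refl _)⟩

/-- The coresolution is spliced with an `𝒳`-resolution built from epimorphisms. To the right the
chain stays coresolved; to the left only Ext-vanishing is propagated, which is all that extending
maps along the monomorphisms requires. -/
lemma isCoresolved_le {𝒳 𝒴 : ObjectProperty C} (h : ExtOrthogonal.{w} 𝒳 𝒴)
    (h' : IsSelfEpic 𝒳) : IsCoresolved.{w} 𝒳 𝒴 ≤ gorensteinProjective 𝒳 𝒴 := by
  intro M hM
  obtain ⟨Z, hZ, H⟩ := exists_int_chain
    (fun A B : C ↦ (∀ Y, 𝒴 Y → ExtVanish.{w} B Y) ∧ ∃ X, 𝒳 X ∧ IsSES A X B)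
    (IsCoresolved.{w} 𝒳 𝒴) (fun A ↦ ∀ Y, 𝒴 Y → ExtVanish.{w} A Y)
    (fun A hA ↦ by
      obtain ⟨W, N, hW, hN, hS⟩ := hA.exists_isSES
      exact ⟨N, ⟨fun Y hY ↦ IsCoresolved.orthogonal _ _ hN hY, W, hW, hS⟩, hN⟩)
    (fun A hA ↦ by
      obtain ⟨X, p, hX, hp⟩ := h' A
      exact ⟨kernel p, ⟨hA, X, hX, isSES_kernel p⟩, fun Y hY n ↦
        (isSES_kernel p).subsingleton_ext_left (h X Y hX hY n) (hA Y hY (n + 1))⟩)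
    M hM (fun Y hY ↦ IsCoresolved.orthogonal _ _ hM hY)
  choose hE X hX i p w hS using H
  obtain ⟨e⟩ := splice_image i p w hS (show (-1 : ℤ) + 1 = 0 by simp)
  refine ⟨splice i p w, ⟨splice_acyclic i p w hS, hX, fun Y hY n f hf ↦ ?_⟩,
    ⟨eqToIso hZ.symm ≪≫ e⟩⟩
  exact splice_hom_acyclic i p w hS (fun n f ↦
    exists_extension_of_subsingleton_ext (hS n) (hE n Y hY 0) f) (by simp) rfl f hf

/-- Coresolutions by `𝒳` may be replaced by coresolutions by a relative cogenerator. -/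
lemma IsCoresolved.of_cogenerator {𝒳 𝒲 𝒴 : ObjectProperty C} (h : ExtOrthogonal.{w} 𝒳 𝒴)
    [𝒳.IsClosedUnderExtensions] (h₀ : ∃ Z, IsZero Z ∧ 𝒳 Z)
    (hc : IsRelativeQuasiCogenerator 𝒲 𝒳) :
    IsCoresolved.{w} 𝒳 𝒴 ≤ IsCoresolved.{w} 𝒲 𝒴 := by
  intro M hM
  obtain ⟨Z, hZ, hXZ⟩ := h₀
  -- The invariant has to allow extensions of `𝒳` by coresolved objects. Pushing `N` out along `M' ⟶
  -- X₁` embeds it in `E ∈ 𝒳`, then `E` embeds in `W ∈ 𝒲`; the cokernel of `N ⟶ W` is an extension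
  -- of `X''` by `M''`, again of this form.
  refine ⟨fun N ↦ ∃ M' X', IsCoresolved.{w} 𝒳 𝒴 M' ∧ 𝒳 X' ∧ IsSES M' N X',
    ⟨M, Z, hM, hXZ, isSES_zero_right hZ M⟩, ?_⟩
  rintro N ⟨M', X', hM', hX', hN⟩
  refine ⟨fun Y hY n ↦ hN.subsingleton_ext_middle (IsCoresolved.orthogonal _ _ hM' hY n)
    (h _ _ hX' hY n), ?_⟩
  obtain ⟨X₁, M'', hX₁, hM'', hS⟩ := hM'.exists_isSES
  obtain ⟨E, hE, hNE⟩ := hN.pushout hS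
  have hXE : 𝒳 E := by
    obtain ⟨_, _, _, hE⟩ := hE
    exact 𝒳.prop_X₂_of_shortExact hE hX₁ hX'
  obtain ⟨W, X'', i, p, w, hW, h𝒲, hX''⟩ := hc E hXE
  obtain ⟨Q, hQ, hQ'⟩ := hNE.comp_mono ⟨i, p, w, hW⟩
  exact ⟨W, Q, h𝒲, ⟨M'', X'', hM'', hX'', hQ'⟩, hQ⟩

end RelGorenstein

/-! ### Closure properties and finite resolutions -/

namespace RelGorenstein

variable {C : Type u} [Category.{v} C] [Abelian C]

section Closure

variable {𝒮 : ObjectProperty C}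

lemma IsSES.prop_middle (h𝒮 : 𝒮.IsClosedUnderExtensions) {A B D : C} (h : IsSES A B D)
    (hA : 𝒮 A) (hD : 𝒮 D) : 𝒮 B := by
  obtain ⟨_, _, _, hS⟩ := h
  exact h𝒮.prop_X₂_of_shortExact hS hA hD

lemma IsSES.prop_left (h𝒮 : ClosedUnderKernelsOfEpis 𝒮) {A B D : C} (h : IsSES A B D)
    (hB : 𝒮 B) (hD : 𝒮 D) : 𝒮 A := by
  obtain ⟨_, _, _, hS⟩ := h
  exact h𝒮 _ hS hB hD

lemma prop_iso_of_finiteCoproducts (h𝒮 : 𝒮.IsClosedUnderFiniteCoproducts) {A B : C} (e : A ≅ B)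
    (hA : 𝒮 A) : 𝒮 B := by
  have := ObjectProperty.IsClosedUnderBinaryCoproducts.closedUnderIsomorphisms 𝒮
  exact 𝒮.prop_of_iso e hA

lemma prop_biprod_of_finiteCoproducts (h𝒮 : 𝒮.IsClosedUnderFiniteCoproducts) {A B : C}
    (hA : 𝒮 A) (hB : 𝒮 B) : 𝒮 (A ⊞ B) :=
  𝒮.prop_of_isColimit_binaryCofan (BinaryBiproduct.isColimit A B) hA hB

lemma prop_zero_of_finiteCoproducts {D : Type u} [Category.{v} D] {𝒮 : ObjectProperty D}
    (h𝒮 : 𝒮.IsClosedUnderFiniteCoproducts) {Z : D}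
    (hZ : IsZero Z) : 𝒮 Z :=
  𝒮.prop_of_isInitial _ hZ.isInitial

lemma isClosedUnderFiniteCoproducts_of_biprod {Z : C} (hZ : IsZero Z) (h₀ : 𝒮 Z)
    (hiso : ∀ {A B : C}, (A ≅ B) → 𝒮 A → 𝒮 B) (hb : ∀ {A B : C}, 𝒮 A → 𝒮 B → 𝒮 (A ⊞ B)) :
    𝒮.IsClosedUnderFiniteCoproducts := by
  have : 𝒮.IsClosedUnderIsomorphisms := ⟨hiso⟩
  have : 𝒮.ContainsZero := ⟨⟨Z, hZ, h₀⟩⟩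
  have : 𝒮.IsClosedUnderBinaryCoproducts :=
    { colimitsOfShape_le := by
        rintro X ⟨p⟩
        exact hiso (IsColimit.coconePointsIsoOfNatIso p.isColimit (BinaryBiproduct.isColimit _ _)
          (diagramIsoPair p.diag)).symm (hb (p.prop_diag_obj _) (p.prop_diag_obj _)) }
  exact ObjectProperty.IsClosedUnderFiniteCoproducts.mk'

lemma isClosedUnderFiniteCoproducts_inf {𝒬 : ObjectProperty C}
    (h𝒮 : 𝒮.IsClosedUnderFiniteCoproducts) (h𝒬 : 𝒬.IsClosedUnderFiniteCoproducts) :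
    (𝒮 ⊓ 𝒬).IsClosedUnderFiniteCoproducts := by
  obtain ⟨Z, hZ⟩ := HasZeroObject.zero (C := C)
  exact isClosedUnderFiniteCoproducts_of_biprod hZ
    ⟨prop_zero_of_finiteCoproducts h𝒮 hZ, prop_zero_of_finiteCoproducts h𝒬 hZ⟩
    (fun e h ↦ ⟨prop_iso_of_finiteCoproducts h𝒮 e h.1, prop_iso_of_finiteCoproducts h𝒬 e h.2⟩)
    (fun h h' ↦ ⟨prop_biprod_of_finiteCoproducts h𝒮 h.1 h'.1,
      prop_biprod_of_finiteCoproducts h𝒬 h.2 h'.2⟩)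

lemma isClosedUnderFiniteCoproducts_of_extensions {Z : C} (hZ : IsZero Z) (h₀ : 𝒮 Z)
    (hE : 𝒮.IsClosedUnderExtensions) : 𝒮.IsClosedUnderFiniteCoproducts :=
  isClosedUnderFiniteCoproducts_of_biprod hZ h₀
    (fun e hA ↦ ((isSES_zero_right hZ _).of_iso (Iso.refl _) e (Iso.refl _)).prop_middle hE hA h₀)
    (fun hA hB ↦ 𝒮.prop_biprod hA hB)

end Closure

lemma IsSES.add_right {A B D : C} (h : IsSES A B D) (M : C) : IsSES A (B ⊞ M) (D ⊞ M) := by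
  obtain ⟨Z, hZ⟩ := HasZeroObject.zero (C := C)
  exact (h.biprod (isSES_zero_left hZ M)).of_iso
    ⟨biprod.fst, biprod.inl, by ext <;> simp [hZ.eq_of_src _ (0 : Z ⟶ _)], by simp⟩
    (Iso.refl _) (Iso.refl _)

section FiniteResolutions

variable {𝒴 : ObjectProperty C}

lemma hasResolution_succ_iff {n : ℕ} {M : C} :
    HasResolution 𝒴 (n + 1) M ↔ ∃ K Y, IsSES K Y M ∧ 𝒴 Y ∧ HasResolution 𝒴 n K := by
  constructor
  · rintro ⟨K, Y, i, p, w, hS, hY, hK⟩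
    exact ⟨K, Y, ⟨i, p, w, hS⟩, hY, hK⟩
  · rintro ⟨K, Y, ⟨i, p, w, hS⟩, hY, hK⟩
    exact ⟨K, Y, i, p, w, hS, hY, hK⟩

lemma HasResolution.of_iso {n : ℕ} {M N : C} (e : M ≅ N) (h : HasResolution 𝒴 n M) :
    HasResolution 𝒴 n N := by
  cases n with
  | zero =>
    obtain ⟨Y, hY, ⟨e'⟩⟩ := h
    exact ⟨Y, hY, ⟨e' ≪≫ e⟩⟩
  | succ n =>
    rw [hasResolution_succ_iff] at h ⊢
    obtain ⟨K, Y, hS, hY, hK⟩ := h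
    exact ⟨K, Y, hS.of_iso (Iso.refl _) (Iso.refl _) e, hY, hK⟩

lemma hasResolution_zero_iff (h𝒴 : 𝒴.IsClosedUnderFiniteCoproducts) {M : C} :
    HasResolution 𝒴 0 M ↔ 𝒴 M :=
  ⟨fun ⟨_, hY, ⟨e⟩⟩ ↦ prop_iso_of_finiteCoproducts h𝒴 e hY, fun h ↦ ⟨M, h, ⟨Iso.refl _⟩⟩⟩

lemma HasResolution.succ (h𝒴 : 𝒴.IsClosedUnderFiniteCoproducts) {n : ℕ} {M : C}
    (h : HasResolution 𝒴 n M) : HasResolution 𝒴 (n + 1) M := by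
  induction n generalizing M with
  | zero =>
    obtain ⟨Z, hZ⟩ := HasZeroObject.zero (C := C)
    rw [hasResolution_succ_iff]
    exact ⟨Z, M, isSES_zero_left hZ M, (hasResolution_zero_iff h𝒴).1 h,
      Z, prop_zero_of_finiteCoproducts h𝒴 hZ, ⟨Iso.refl _⟩⟩
  | succ n ih =>
    rw [hasResolution_succ_iff] at h ⊢
    obtain ⟨K, Y, hS, hY, hK⟩ := h
    exact ⟨K, Y, hS, hY, ih hK⟩

lemma HasResolution.of_le (h𝒴 : 𝒴.IsClosedUnderFiniteCoproducts) {m n : ℕ} (hmn : m ≤ n) {M : C}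
    (h : HasResolution 𝒴 m M) : HasResolution 𝒴 n M :=
  Nat.le_induction h (fun _ _ h' ↦ h'.succ h𝒴) n hmn

lemma le_finiteRes : 𝒴 ≤ finiteRes 𝒴 := fun M hM ↦ ⟨0, M, hM, ⟨Iso.refl _⟩⟩

lemma HasResolution.biprod (h𝒴 : 𝒴.IsClosedUnderFiniteCoproducts) {n : ℕ} {M N : C}
    (hM : HasResolution 𝒴 n M) (hN : HasResolution 𝒴 n N) : HasResolution 𝒴 n (M ⊞ N) := by
  induction n generalizing M N with
  | zero =>
    rw [hasResolution_zero_iff h𝒴] at hM hN ⊢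
    exact prop_biprod_of_finiteCoproducts h𝒴 hM hN
  | succ n ih =>
    rw [hasResolution_succ_iff] at hM hN ⊢
    obtain ⟨K, Y, hS, hY, hK⟩ := hM
    obtain ⟨K', Y', hS', hY', hK'⟩ := hN
    exact ⟨_, _, hS.biprod hS', prop_biprod_of_finiteCoproducts h𝒴 hY hY', ih hK hK'⟩

lemma isClosedUnderFiniteCoproducts_finiteRes (h𝒴 : 𝒴.IsClosedUnderFiniteCoproducts) :
    (finiteRes 𝒴).IsClosedUnderFiniteCoproducts := by
  obtain ⟨Z, hZ⟩ := HasZeroObject.zero (C := C)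
  refine isClosedUnderFiniteCoproducts_of_biprod hZ
    (le_finiteRes _ (prop_zero_of_finiteCoproducts h𝒴 hZ)) (fun e ⟨n, h⟩ ↦ ⟨n, h.of_iso e⟩) ?_
  rintro A B ⟨m, hA⟩ ⟨n, hB⟩
  exact ⟨max m n, (hA.of_le h𝒴 (le_max_left m n)).biprod h𝒴 (hB.of_le h𝒴 (le_max_right m n))⟩

variable [HasExt.{w} C]

lemma ExtOrthogonal.finiteRes {𝒳 : ObjectProperty C} (h : ExtOrthogonal.{w} 𝒳 𝒴) :
    ExtOrthogonal.{w} 𝒳 (finiteRes 𝒴) := by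
  rintro X M hX ⟨n, hM⟩
  induction n generalizing M with
  | zero =>
    obtain ⟨Y, hY, ⟨e⟩⟩ := hM
    exact fun n ↦ subsingleton_ext_of_retract' e.symm.retract (h X Y hX hY n)
  | succ n ih =>
    rw [hasResolution_succ_iff] at hM
    obtain ⟨K, Y, hS, hY, hK⟩ := hM
    exact fun n ↦ hS.subsingleton_ext_right' (ih K hK (n + 1)) (h X Y hX hY n)

/-- Horseshoe lemma: the pullback of `B` and `Y'` over `D` is an extension of `Y'` by `A`, split
because `Ext¹(Y', A) = 0`. Hence `Y ⊞ Y'` maps onto `B`, with kernel an extension of `D'` by `A'`.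
-/
lemma HasResolution.extension (h𝒴 : 𝒴.IsClosedUnderFiniteCoproducts)
    (h : ExtOrthogonal.{w} 𝒴 𝒴) {n : ℕ} {A B D : C} (hS : IsSES A B D)
    (hA : HasResolution 𝒴 n A) (hD : HasResolution 𝒴 n D) : HasResolution 𝒴 n B := by
  induction n generalizing A B D with
  | zero =>
    rw [hasResolution_zero_iff h𝒴] at hA hD ⊢
    obtain ⟨e⟩ := hS.split (h D A hD hA 0)
    exact prop_iso_of_finiteCoproducts h𝒴 e.symm (prop_biprod_of_finiteCoproducts h𝒴 hA hD)
  | succ n ih =>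
    have hA₀ := hA
    rw [hasResolution_succ_iff] at hA hD ⊢
    obtain ⟨A', Y, hSA, hY, hA'⟩ := hA
    obtain ⟨D', Y', hSD, hY', hD'⟩ := hD
    obtain ⟨P, hP, hP'⟩ := hS.pullback hSD
    obtain ⟨e⟩ := hP.split (h.finiteRes Y' A hY' ⟨_, hA₀⟩ 0)
    obtain ⟨Q, hQ, hQ'⟩ := ((hSA.add_right Y').of_iso (Iso.refl _) (Iso.refl _) e.symm).comp_epi hP'
    exact ⟨Q, _, hQ, prop_biprod_of_finiteCoproducts h𝒴 hY hY', ih hQ' hA' hD'⟩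

lemma isClosedUnderExtensions_finiteRes (h𝒴 : 𝒴.IsClosedUnderFiniteCoproducts)
    (h : ExtOrthogonal.{w} 𝒴 𝒴) : (finiteRes 𝒴).IsClosedUnderExtensions where
  prop_X₂_of_shortExact := by
    rintro S hS ⟨m, hA⟩ ⟨n, hB⟩
    exact ⟨max m n, HasResolution.extension h𝒴 h (isSES_of_shortExact hS)
      (hA.of_le h𝒴 (le_max_left m n)) (hB.of_le h𝒴 (le_max_right m n))⟩

lemma closedUnderCokernelsOfMonos_finiteRes (h𝒴 : 𝒴.IsClosedUnderFiniteCoproducts)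
    (h : ExtOrthogonal.{w} 𝒴 𝒴) : ClosedUnderCokernelsOfMonos (finiteRes 𝒴) := by
  rintro S hS hA ⟨n, hB⟩
  -- Lengthening the resolution provides an epimorphism `Y ⟶ S.X₂` even when `n = 0`. The kernel of
  -- `Y ⟶ S.X₃` is then an extension of `S.X₁` by `B'`.
  have hB' := hB.succ h𝒴
  rw [hasResolution_succ_iff] at hB'
  obtain ⟨B', Y, hSB, hY, hB'⟩ := hB'
  obtain ⟨P, hP, hP'⟩ := hSB.comp_epi (isSES_of_shortExact hS)
  obtain ⟨m, hm⟩ := hP'.prop_middle (isClosedUnderExtensions_finiteRes h𝒴 h) ⟨n, hB'⟩ hA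
  exact ⟨m + 1, hasResolution_succ_iff.2 ⟨P, Y, hP, hY, hm⟩⟩

end FiniteResolutions

/-! ### Resolution dimension and Auslander–Buchweitz approximation -/

section ResolutionDimension

/-- The objects whose `n`-th syzygy in every `𝒢`-resolution belongs to `𝒢`. -/
def SyzygyIn (𝒢 : ObjectProperty C) : ℕ → ObjectProperty C
  | 0 => 𝒢
  | n + 1 => fun M => ∀ K G, 𝒢 G → IsSES K G M → SyzygyIn 𝒢 n K

variable {𝒢 : ObjectProperty C}

lemma SyzygyIn.extension (h𝒢 : IsLeftThick 𝒢) {n : ℕ} {A B G : C} (hS : IsSES A B G)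
    (hA : SyzygyIn 𝒢 n A) (hG : 𝒢 G) : SyzygyIn 𝒢 n B := by
  cases n with
  | zero => exact hS.prop_middle h𝒢.extensions hA hG
  | succ n =>
    intro L G₁ hG₁ hL
    obtain ⟨H, hH, hH'⟩ := hL.comp_epi hS
    exact hA L H (hH.prop_left h𝒢.kernels hG₁ hG) hH'

/-- A cover `G₂` of `B` restricts to a cover `H ∈ 𝒢` of `A` with the same kernel. The pullback of
`H` and `G₁` over `A` is an extension of `G₁` by that syzygy of `B`, and `L` is the kernel of its
map onto `H`, so induction applies. -/
lemma SyzygyIn.kernel (h𝒢 : IsLeftThick 𝒢) (hepi : IsSelfEpic 𝒢) {n : ℕ} {A B G : C}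
    (hS : IsSES A B G) (hB : SyzygyIn 𝒢 n B) (hG : 𝒢 G) : SyzygyIn 𝒢 n A := by
  induction n generalizing A B G with
  | zero => exact hS.prop_left h𝒢.kernels hB hG
  | succ n ih =>
    intro L G₁ hG₁ hL
    obtain ⟨G₂, p, hG₂, hp⟩ := hepi B
    obtain ⟨H, hH, hH'⟩ := (isSES_kernel p).comp_epi hS
    obtain ⟨Q, hQ, hQ'⟩ := hH'.pullback hL
    exact ih hQ' ((hB _ _ hG₂ (isSES_kernel p)).extension h𝒢 hQ hG₁)
      (hH.prop_left h𝒢.kernels hG₂ hG)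

/-- A single syzygy determines the condition on all the others. -/
lemma SyzygyIn.of_isSES (h𝒢 : IsLeftThick 𝒢) (hepi : IsSelfEpic 𝒢) {n : ℕ} {K G M : C}
    (hS : IsSES K G M) (hG : 𝒢 G) (hK : SyzygyIn 𝒢 n K) : SyzygyIn 𝒢 (n + 1) M := by
  intro L G₁ hG₁ hL
  -- Schanuel's argument: `Q` is an extension of `G₁` by `K` and of `G` by `L`.
  obtain ⟨Q, hQ, hQ'⟩ := hS.pullback hL
  exact (hK.extension h𝒢 hQ hG₁).kernel h𝒢 hepi hQ' hG

lemma SyzygyIn.of_hasResolution (h𝒢 : IsLeftThick 𝒢) (hepi : IsSelfEpic 𝒢)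
    {𝒴 : ObjectProperty C} (h : 𝒴 ≤ 𝒢) {n : ℕ} {M : C} (hM : HasResolution 𝒴 n M) :
    SyzygyIn 𝒢 n M := by
  induction n generalizing M with
  | zero =>
    obtain ⟨Y, hY, ⟨e⟩⟩ := hM
    have := h𝒢.summands
    exact 𝒢.prop_of_retract e.symm.retract (h _ hY)
  | succ n ih =>
    obtain ⟨K, Y, hS, hY, hK⟩ := hasResolution_succ_iff.1 hM
    exact SyzygyIn.of_isSES h𝒢 hepi hS (h _ hY) (ih hK)

/-- Because `SyzygyIn` quantifies over all covers, it may be tested on the direct sum of a cover of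
`M` and one of `N`. -/
lemma SyzygyIn.of_biprod (h𝒢 : IsLeftThick 𝒢) (hepi : IsSelfEpic 𝒢) {n : ℕ} {M N : C}
    (h : SyzygyIn 𝒢 n (M ⊞ N)) : SyzygyIn 𝒢 n M := by
  induction n generalizing M N with
  | zero =>
    have := h𝒢.summands
    exact ObjectProperty.IsStableUnderRetracts.of_biprod_left 𝒢 h
  | succ n ih =>
    intro K G hG hK
    obtain ⟨G', p, hG', hp⟩ := hepi N
    have := h𝒢.extensions
    exact ih (h _ _ (𝒢.prop_biprod hG hG') (hK.biprod (isSES_kernel p)))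

variable [HasExt.{w} C] {𝒴 : ObjectProperty C}

/-- Auslander–Buchweitz approximations. -/
lemma SyzygyIn.exists_approximation (h : IsLeftFrobeniusPair.{w} 𝒢 𝒴) (hepi : IsSelfEpic 𝒢)
    (h𝒴 : 𝒴.IsClosedUnderFiniteCoproducts) {n : ℕ} {M : C} (hM : SyzygyIn 𝒢 n M) :
    ∃ K G, IsSES K G M ∧ 𝒢 G ∧ finiteRes 𝒴 K := by
  induction n generalizing M with
  | zero =>
    obtain ⟨Z, hZ⟩ := HasZeroObject.zero (C := C)
    exact ⟨Z, M, isSES_zero_left hZ M, hM, le_finiteRes _ (prop_zero_of_finiteCoproducts h𝒴 hZ)⟩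
  | succ n ih =>
    obtain ⟨G, p, hG, hp⟩ := hepi M
    obtain ⟨K', G', hK', hG', n, hn⟩ := ih (hM _ _ hG (isSES_kernel p))
    -- Enlarging `G'` to `Y` turns the approximation of the syzygy into an embedding of it in `E = Y
    -- / K' ∈ 𝒴^∧` with cokernel `G''`; pushing `G` out along this embedding gives `T`.
    obtain ⟨Y, G'', i, q, w, hY, h𝒴Y, hG''⟩ := h.cogenerator.2 G' hG'
    obtain ⟨E, hE, hE'⟩ := hK'.comp_mono ⟨i, q, w, hY⟩
    obtain ⟨T, hT, hT'⟩ := (isSES_kernel p).pushout hE'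
    exact ⟨E, T, hT, hT'.prop_middle h.leftThick.extensions hG hG'',
      n + 1, hasResolution_succ_iff.2 ⟨K', Y, hE, h𝒴Y, hn⟩⟩

/-- A summand `M` has finite `𝒢`-resolution dimension, hence an approximation `K ⟶ G ⟶ M` with `K ∈
𝒴^∧`. Both `K` and `M` have no extensions by `𝒢`, so neither has `G`; its embedding in an object of
`𝒴` splits and `G ∈ 𝒴`. -/
lemma isStableUnderRetracts_finiteRes (h : IsLeftFrobeniusPair.{w} 𝒢 𝒴) (hepi : IsSelfEpic 𝒢)
    (h𝒴 : 𝒴.IsClosedUnderFiniteCoproducts) : (finiteRes 𝒴).IsStableUnderRetracts where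
  of_retract {M L} r hL := by
    have horth := (relIdClass_eq_zero_iff 𝒢 𝒴).1 h.injective
    obtain ⟨N, ⟨e⟩⟩ := exists_iso_biprod_of_retract r
    obtain ⟨n, hn⟩ := hL
    have hM := (SyzygyIn.of_hasResolution h.leftThick hepi h.cogenerator.1
      (hn.of_iso e)).of_biprod h.leftThick hepi
    obtain ⟨K, G, hS, hG, m, hm⟩ := hM.exists_approximation h hepi h𝒴
    refine ⟨m + 1, hasResolution_succ_iff.2 ⟨K, G, hS, ?_, hm⟩⟩
    obtain ⟨Y, G', i, q, w, hY, h𝒴Y, hG'⟩ := h.cogenerator.2 G hG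
    have hE := hS.subsingleton_ext_middle' (horth.finiteRes G' K hG' ⟨m, hm⟩ 0)
      (subsingleton_ext_of_retract' r (horth.finiteRes G' L hG' ⟨n, hn⟩ 0))
    obtain ⟨r'⟩ := IsSES.retract_of_subsingleton_ext ⟨i, q, w, hY⟩ hE
    have := h.summands
    exact 𝒴.prop_of_retract r' h𝒴Y

end ResolutionDimension

end RelGorenstein

/-! ### Left thickness of the coresolved objects -/

namespace RelGorenstein

variable {C : Type u} [Category.{v} C] [Abelian C] [HasExt.{w} C]

namespace IsCoresolved

variable {𝒲 𝒴 : ObjectProperty C}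

lemma of_iso {M N : C} (e : M ≅ N) (hM : IsCoresolved.{w} 𝒲 𝒴 M) : IsCoresolved.{w} 𝒲 𝒴 N := by
  obtain ⟨W, M', hW, hM', hS⟩ := hM.exists_isSES
  exact .of_isSES (hS.of_iso e (Iso.refl _) (Iso.refl _)) hW hM' fun Y hY n ↦
    subsingleton_ext_of_retract e.symm.retract (orthogonal _ _ hM hY n)

/-- Dual horseshoe: `𝒲 ≤ 𝒴` makes `Ext¹(D, W)` vanish, so the pushout of `N` along `A ⟶ W` is `W ⊞
D`, which embeds in `W ⊞ W'`. -/
lemma extension (h𝒲 : 𝒲.IsClosedUnderFiniteCoproducts) (h : 𝒲 ≤ 𝒴) {A B D : C}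
    (hS : IsSES A B D) (hA : IsCoresolved.{w} 𝒲 𝒴 A) (hD : IsCoresolved.{w} 𝒲 𝒴 D) :
    IsCoresolved.{w} 𝒲 𝒴 B := by
  refine ⟨fun N ↦ ∃ A D, IsCoresolved.{w} 𝒲 𝒴 A ∧ IsCoresolved.{w} 𝒲 𝒴 D ∧ IsSES A N D,
    ⟨A, D, hA, hD, hS⟩, ?_⟩
  rintro N ⟨A, D, hA, hD, hN⟩
  refine ⟨fun Y hY n ↦ hN.subsingleton_ext_middle (orthogonal _ _ hA hY n)
    (orthogonal _ _ hD hY n), ?_⟩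
  obtain ⟨W, A', hW, hA', hSA⟩ := hA.exists_isSES
  obtain ⟨W', D', hW', hD', hSD⟩ := hD.exists_isSES
  obtain ⟨E, hE, hNE⟩ := hN.pushout hSA
  obtain ⟨e⟩ := hE.split (orthogonal _ _ hD (h _ hW) 0)
  obtain ⟨Q, hQ, hQ'⟩ :=
    hNE.comp_mono ((hSD.add_left W).of_iso e.symm (Iso.refl _) (Iso.refl _))
  exact ⟨_, Q, prop_biprod_of_finiteCoproducts h𝒲 hW hW', ⟨A', D', hA', hD', hQ'⟩, hQ⟩

/-- The composite `A ⟶ B ⟶ W` has as cokernel an extension of `B'` by `D`. -/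
lemma kernel (h𝒲 : 𝒲.IsClosedUnderFiniteCoproducts) (h : 𝒲 ≤ 𝒴) {A B D : C}
    (hS : IsSES A B D) (hB : IsCoresolved.{w} 𝒲 𝒴 B) (hD : IsCoresolved.{w} 𝒲 𝒴 D) :
    IsCoresolved.{w} 𝒲 𝒴 A := by
  obtain ⟨W, B', hW, hB', hSB⟩ := hB.exists_isSES
  obtain ⟨Q, hQ, hQ'⟩ := hS.comp_mono hSB
  exact .of_isSES hQ hW (.extension h𝒲 h hQ' hD hB') fun Y hY n ↦
    hS.subsingleton_ext_left (orthogonal _ _ hB hY n) (orthogonal _ _ hD hY (n + 1))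

lemma of_biprod (h𝒲 : 𝒲.IsClosedUnderFiniteCoproducts) (h : 𝒲 ≤ 𝒴) {M N : C}
    (hMN : IsCoresolved.{w} 𝒲 𝒴 (M ⊞ N)) : IsCoresolved.{w} 𝒲 𝒴 M := by
  -- The complement may change along the coresolution: the cokernel `Q` of `A ⟶ A ⊞ B ⟶ W` is an
  -- extension of `G` by `B`, so `A ⊞ Q` is one of `G` by `A ⊞ B`, and `A` serves as complement of
  -- `Q`.
  refine ⟨fun A ↦ ∃ B, IsCoresolved.{w} 𝒲 𝒴 (A ⊞ B), ⟨N, hMN⟩, ?_⟩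
  rintro A ⟨B, hAB⟩
  refine ⟨fun Y hY n ↦ subsingleton_ext_of_retract ⟨biprod.inl, biprod.fst, by simp⟩
    (orthogonal _ _ hAB hY n), ?_⟩
  obtain ⟨W, G, hW, hG, hS⟩ := hAB.exists_isSES
  obtain ⟨Q, hQ, hQ'⟩ := (isSES_biprod A B).comp_mono hS
  exact ⟨W, Q, hW,
    ⟨A, (extension h𝒲 h (hQ'.add_left A) hAB hG).of_iso (biprod.braiding A Q)⟩, hQ⟩

lemma isLeftThick (h𝒲 : 𝒲.IsClosedUnderFiniteCoproducts) (h : 𝒲 ≤ 𝒴) :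
    IsLeftThick (IsCoresolved.{w} 𝒲 𝒴) where
  extensions := ⟨fun hS hA hD ↦ extension h𝒲 h (isSES_of_shortExact hS) hA hD⟩
  kernels _ hS hB hD := kernel h𝒲 h (isSES_of_shortExact hS) hB hD
  summands := ⟨fun {M N} r hN ↦ by
    obtain ⟨_, ⟨e⟩⟩ := exists_iso_biprod_of_retract r
    exact of_biprod h𝒲 h (hN.of_iso e)⟩

lemma isRelativeQuasiCogenerator :
    IsRelativeQuasiCogenerator 𝒲 (IsCoresolved.{w} 𝒲 𝒴) := by
  intro M hM
  obtain ⟨W, N, hW, hN, i, p, w, hS⟩ := hM.exists_isSES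
  exact ⟨W, N, i, p, w, hS, hW, hN⟩

/-- A coresolved object without extensions by cosyzygies is a direct summand of an object
of `𝒲`. -/
lemma exists_retract {M : C} (hM : IsCoresolved.{w} 𝒲 𝒴 M) {𝒵 : ObjectProperty C}
    (h : ExtOrthogonal.{w} (IsCoresolved.{w} 𝒲 𝒴) 𝒵) (hZ : 𝒵 M) :
    ∃ W, 𝒲 W ∧ Nonempty (Retract M W) := by
  obtain ⟨W, N, hW, hN, hS⟩ := hM.exists_isSES
  exact ⟨W, hW, hS.retract_of_subsingleton_ext (h N M hN hZ 0)⟩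

end IsCoresolved

/-! ### Gorenstein projectives of a GP-admissible pair -/

namespace IsGPAdmissible

variable {𝒳 𝒴 : ObjectProperty C} (h : IsGPAdmissible.{w} 𝒳 𝒴)

include h

lemma orthogonal : ExtOrthogonal.{w} 𝒳 𝒴 := (relPdClass_eq_zero_iff 𝒴 𝒳).1 h.pd_eq_zero

lemma gorensteinProjective_eq :
    gorensteinProjective 𝒳 𝒴 = IsCoresolved.{w} (𝒳 ⊓ 𝒴) 𝒴 := by
  obtain ⟨Z, hZ⟩ := HasZeroObject.zero (C := C)
  have := h.left_extensions
  refine le_antisymm ((gorensteinProjective_le h.orthogonal).trans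
    (IsCoresolved.of_cogenerator h.orthogonal
      ⟨Z, hZ, prop_zero_of_finiteCoproducts h.left_coproducts hZ⟩ h.cogenerator.2)) ?_
  exact (IsCoresolved.mono inf_le_left le_rfl).trans (isCoresolved_le h.orthogonal h.epic)

/-- The cogenerator sequences keep all cosyzygies inside `𝒳`, so `𝒳` itself is the invariant class.
-/
lemma le_gorensteinProjective : 𝒳 ≤ gorensteinProjective 𝒳 𝒴 := by
  rw [h.gorensteinProjective_eq]
  intro X hX
  refine ⟨𝒳, hX, fun N hN ↦ ⟨fun Y hY ↦ h.orthogonal _ _ hN hY, ?_⟩⟩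
  obtain ⟨W, X', i, p, w, hS, hW, hX'⟩ := h.cogenerator.2 N hN
  exact ⟨W, X', hW, hX', i, p, w, hS⟩

lemma isLeftThick_gorensteinProjective : IsLeftThick (gorensteinProjective 𝒳 𝒴) := by
  rw [h.gorensteinProjective_eq]
  exact IsCoresolved.isLeftThick
    (isClosedUnderFiniteCoproducts_inf h.left_coproducts h.right_coproducts) inf_le_right

lemma orthogonal_gorensteinProjective : ExtOrthogonal.{w} (gorensteinProjective 𝒳 𝒴) 𝒴 := by
  rw [h.gorensteinProjective_eq]
  exact IsCoresolved.orthogonal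

lemma quasiCogenerator_gorensteinProjective :
    IsRelativeQuasiCogenerator (𝒳 ⊓ 𝒴) (gorensteinProjective 𝒳 𝒴) := by
  rw [h.gorensteinProjective_eq]
  exact IsCoresolved.isRelativeQuasiCogenerator

lemma isSelfEpic_gorensteinProjective : IsSelfEpic (gorensteinProjective 𝒳 𝒴) := fun A ↦ by
  obtain ⟨X, p, hX, hp⟩ := h.epic A
  exact ⟨X, p, h.le_gorensteinProjective _ hX, hp⟩

/-- Replacing `𝒳` by the Gorenstein projectives and `𝒴` by a class between `𝒳 ⊓ 𝒴` and `𝒴`. -/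
lemma gorensteinProjective_left {𝒵 : ObjectProperty C} (h₁ : 𝒳 ⊓ 𝒴 ≤ 𝒵) (h₂ : 𝒵 ≤ 𝒴)
    (h𝒵 : 𝒵.IsClosedUnderFiniteCoproducts) :
    IsGPAdmissible.{w} (gorensteinProjective 𝒳 𝒴) 𝒵 where
  pd_eq_zero := (relPdClass_eq_zero_iff _ _).2 fun M Z hM hZ ↦
    h.orthogonal_gorensteinProjective M Z hM (h₂ _ hZ)
  epic := h.isSelfEpic_gorensteinProjective
  left_coproducts := by
    obtain ⟨Z, hZ⟩ := HasZeroObject.zero (C := C)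
    exact isClosedUnderFiniteCoproducts_of_extensions hZ
      (h.le_gorensteinProjective _ (prop_zero_of_finiteCoproducts h.left_coproducts hZ))
      h.isLeftThick_gorensteinProjective.extensions
  right_coproducts := h𝒵
  left_extensions := h.isLeftThick_gorensteinProjective.extensions
  cogenerator := ⟨inf_le_left, fun M hM ↦ by
    obtain ⟨W, N, i, p, w, hS, hW, hN⟩ := h.quasiCogenerator_gorensteinProjective M hM
    exact ⟨W, N, i, p, w, hS, ⟨h.le_gorensteinProjective _ hW.1, h₁ _ hW⟩, hN⟩⟩

lemma finiteRes_right : IsGPAdmissible.{w} 𝒳 (finiteRes 𝒴) where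
  pd_eq_zero := (relPdClass_eq_zero_iff _ _).2 h.orthogonal.finiteRes
  epic := h.epic
  left_coproducts := h.left_coproducts
  right_coproducts := isClosedUnderFiniteCoproducts_finiteRes h.right_coproducts
  left_extensions := h.left_extensions
  cogenerator := ⟨inf_le_left, fun M hM ↦ by
    obtain ⟨W, N, i, p, w, hS, hW, hN⟩ := h.cogenerator.2 M hM
    exact ⟨W, N, i, p, w, hS, ⟨hW.1, le_finiteRes _ hW.2⟩, hN⟩⟩

lemma isLeftFrobeniusPair (h𝒴 : 𝒴.IsStableUnderRetracts) (hle : 𝒴 ≤ gorensteinProjective 𝒳 𝒴) :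
    IsLeftFrobeniusPair.{w} (gorensteinProjective 𝒳 𝒴) 𝒴 where
  leftThick := h.isLeftThick_gorensteinProjective
  summands := h𝒴
  injective := (relIdClass_eq_zero_iff _ _).2 h.orthogonal_gorensteinProjective
  cogenerator := ⟨hle, fun M hM ↦ by
    obtain ⟨W, N, i, p, w, hS, hW, hN⟩ := h.quasiCogenerator_gorensteinProjective M hM
    exact ⟨W, N, i, p, w, hS, hW.2, hN⟩⟩

lemma exists_retract {M : C} (hM : gorensteinProjective 𝒳 𝒴 M) (hY : finiteRes 𝒴 M) :
    ∃ W, (𝒳 ⊓ 𝒴) W ∧ Nonempty (Retract M W) := by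
  rw [h.gorensteinProjective_eq] at hM
  exact hM.exists_retract IsCoresolved.orthogonal.finiteRes hY

lemma inf_finiteRes_eq (hω : (𝒳 ⊓ 𝒴).IsStableUnderRetracts) :
    gorensteinProjective 𝒳 𝒴 ⊓ finiteRes 𝒴 = 𝒳 ⊓ 𝒴 := by
  refine le_antisymm ?_ (inf_le_inf h.le_gorensteinProjective le_finiteRes)
  rintro M ⟨hM, hY⟩
  obtain ⟨W, hW, ⟨r⟩⟩ := h.exists_retract hM hY
  exact hω.of_retract r hW

lemma gorensteinProjective_finiteRes :
    gorensteinProjective 𝒳 (finiteRes 𝒴) = gorensteinProjective 𝒳 𝒴 := by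
  refine le_antisymm ?_ ?_
  · rintro M ⟨K, hK, e⟩
    exact ⟨K, ⟨hK.acyclic, hK.mem, fun Y hY ↦ hK.hom_acyclic Y (le_finiteRes _ hY)⟩, e⟩
  · rw [h.gorensteinProjective_eq, h.finiteRes_right.gorensteinProjective_eq]
    rintro M ⟨P, hM, hP⟩
    refine ⟨P, hM, fun N hN ↦ ⟨fun Y hY ↦ ?_, ?_⟩⟩
    -- The same coresolution serves: orthogonality of its cosyzygies to `𝒴` passes to `𝒴^∧` by
    -- dimension shifting.
    · exact ExtOrthogonal.finiteRes (𝒳 := P) (fun A Y hA hY ↦ (hP A hA).1 Y hY) N Y hN hY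
    · obtain ⟨W, N', hW, hN', hS⟩ := (hP N hN).2
      exact ⟨W, N', ⟨hW.1, le_finiteRes _ hW.2⟩, hN', hS⟩

end IsGPAdmissible

end RelGorenstein

theorem theorem3p20 {C : Type u} [Category.{v} C] [Abelian C] [HasExt.{w} C]
    (𝒳 𝒴 ω : ObjectProperty C) (hω : ω = 𝒳 ⊓ 𝒴)
    (h : RelGorenstein.IsGPAdmissible.{w} 𝒳 𝒴) :
    -- (a)
    (RelGorenstein.IsGPAdmissible.{w} (RelGorenstein.gorensteinProjective 𝒳 𝒴) 𝒴 ∧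
      RelGorenstein.IsGPAdmissible.{w} (RelGorenstein.gorensteinProjective 𝒳 𝒴) ω ∧
      RelGorenstein.IsGPAdmissible.{w} 𝒳 (RelGorenstein.finiteRes 𝒴)) ∧
    -- (b)
    (𝒴.IsStableUnderRetracts → 𝒴 ≤ RelGorenstein.gorensteinProjective 𝒳 𝒴 →
      RelGorenstein.IsLeftFrobeniusPair.{w} (RelGorenstein.gorensteinProjective 𝒳 𝒴) 𝒴 ∧
      (∀ Y : C, 𝒴 Y → ∃ X : C, 𝒳 X ∧ Nonempty (Retract Y X)) ∧
      RelGorenstein.IsRightThick (RelGorenstein.finiteRes 𝒴)) ∧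
    -- (c)
    (ω.IsStableUnderRetracts → RelGorenstein.gorensteinProjective 𝒳 𝒴 ⊓ 𝒴 = ω) ∧
    -- (d)
    ((RelGorenstein.finiteRes 𝒴).IsStableUnderRetracts → ω.IsStableUnderRetracts →
      (𝒳 ⊓ RelGorenstein.finiteRes 𝒴).IsStableUnderRetracts →
      RelGorenstein.gorensteinProjective 𝒳 𝒴 =
          RelGorenstein.gorensteinProjective 𝒳 (RelGorenstein.finiteRes 𝒴) ∧
        RelGorenstein.gorensteinProjective 𝒳 𝒴 ⊓ RelGorenstein.finiteRes 𝒴 = ω ∧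
        ω = 𝒳 ⊓ RelGorenstein.finiteRes 𝒴) := by
  subst hω
  have hω := RelGorenstein.isClosedUnderFiniteCoproducts_inf h.left_coproducts h.right_coproducts
  refine ⟨⟨h.gorensteinProjective_left inf_le_right le_rfl h.right_coproducts,
    h.gorensteinProjective_left le_rfl inf_le_right hω, h.finiteRes_right⟩, ?_, ?_, ?_⟩
  · intro h𝒴 hle
    have hF := h.isLeftFrobeniusPair h𝒴 hle
    have hYY : RelGorenstein.ExtOrthogonal.{w} 𝒴 𝒴 := fun A B hA hB ↦
      h.orthogonal_gorensteinProjective A B (hle _ hA) hB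
    refine ⟨hF, fun Y hY ↦ ?_,
      RelGorenstein.isClosedUnderExtensions_finiteRes h.right_coproducts hYY,
      RelGorenstein.closedUnderCokernelsOfMonos_finiteRes h.right_coproducts hYY,
      RelGorenstein.isStableUnderRetracts_finiteRes hF h.isSelfEpic_gorensteinProjective
        h.right_coproducts⟩
    obtain ⟨W, hW, r⟩ := h.exists_retract (hle _ hY) (RelGorenstein.le_finiteRes _ hY)
    exact ⟨W, hW.1, r⟩
  · intro hr
    refine le_antisymm ?_ (inf_le_inf_right _ h.le_gorensteinProjective)
    exact (inf_le_inf_left _ RelGorenstein.le_finiteRes).trans (h.inf_finiteRes_eq hr).le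
  · intro _ hr _
    -- The last equality is the sandwich `ω ≤ 𝒳 ⊓ 𝒴^∧ ≤ 𝒢𝒫 ⊓ 𝒴^∧ = ω`.
    refine ⟨h.gorensteinProjective_finiteRes.symm, h.inf_finiteRes_eq hr,
      le_antisymm (inf_le_inf_left _ RelGorenstein.le_finiteRes) ?_⟩
    exact (inf_le_inf_right _ h.le_gorensteinProjective).trans (h.inf_finiteRes_eq hr).le
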